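/- A practical regular expression (PRE) over an alphabet $\Sigma$ is built from $\emptyset$, $\varepsilon$ and the letters of $\Sigma$ by union, concatenation, star, parenthesised subexpressions (groups) and back references $\backslash k$. Groups are numbered $1,2,\dots$ by their opening parentheses from left to right. A PRE is valid if every $\backslash k$ is preceded by the complete $k$-th group; only valid PRE are considered. When a string is matched from left to right, $\backslash k$ matches exactly the string most recently matched by the $k$-th group, and it matches nothing if the $k$-th group has not been matched before. The variables of a PRE are the groups that are referenced by at least one back reference; they are non-nested if no group that is a variable contains another group that is a variable or a back reference. Let $\mathcal{C}_b$ be the class of languages over $\Sigma$ characterized by PRE with at most $b$ variables, and let $\mathcal{N}_b$ be the class of those characterized by PRE with at most $b$ variables that are non-nested. Theorem. Let $\Sigma$ be an alphabet containing three distinct letters $0$, $1$, $\#$. For every integer $b>0$ we have $\mathcal{N}_{b-1}\subsetneq\mathcal{N}_b$. Moreover the language $$L_b=\{w_1\#w_2\#\cdots\#w_b\#w_b\#\cdots\#w_2\#w_1 \mid w_1,\dots,w_b\in\{0,1\}^*\}$$ belongs to $\mathcal{N}_b$ but not to $\mathcal{C}_{b-1}$; that is, it is characterized by a PRE with $b$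 non-nested variables, but by no PRE with at most $b-1$ variables, nested or not. -/

import Mathlib

/-- Practical regular expressions over an alphabet `A`: classical regular expressions together
with parenthesised subexpressions `group r` and back references `backref k` (written `\k`).
The groups of an expression are numbered `1, 2, …` in the order of their opening parentheses,
and `\k` refers to the `k`-th group. (Parentheses that only serve the unique readability of an
expression need not be written in a syntax tree; writing them as a `group` is harmless.) -/
inductive PRE (A : Type*) where
  | zero : PRE A
  | epsilon : PRE A
  | char : A → PRE A
  | union : PRE A → PRE A → PRE A
  | concat : PRE A → PRE A → PRE A
  | star : PRE A → PRE A
  | group : PRE A → PRE A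
  | backref : ℕ → PRE A

namespace PRE

variable {A : Type*}

/-- The number of groups (pairs of parentheses) of an expression. -/
def numGroups : PRE A → ℕ
  | zero => 0
  | epsilon => 0
  | char _ => 0
  | union r s => numGroups r + numGroups s
  | concat r s => numGroups r + numGroups s
  | star r => numGroups r
  | group r => numGroups r + 1
  | backref _ => 0

/-- `ValidAt m O r`: every back reference `\k` in `r` is preceded by the `k`-th group, where `r`
is a subexpression of a larger expression in which `m` groups have been opened to the left of
`r`, those with a number in `O` being still open (that is, they enclose `r`). -/
def ValidAt : ℕ → Finset ℕ → PRE A → Prop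
  | _, _, zero => True
  | _, _, epsilon => True
  | _, _, char _ => True
  | m, O, union r s => ValidAt m O r ∧ ValidAt (m + numGroups r) O s
  | m, O, concat r s => ValidAt m O r ∧ ValidAt (m + numGroups r) O s
  | m, O, star r => ValidAt m O r
  | m, O, group r => ValidAt (m + 1) (insert (m + 1) O) r
  | m, O, backref k => 1 ≤ k ∧ k ≤ m ∧ k ∉ O

/-- An expression is valid if every back reference `\k` is preceded by the (complete) `k`-th
group. -/
def Valid (r : PRE A) : Prop := ValidAt 0 ∅ r

/-- The variables of an expression: the numbers of the groups that are referenced. -/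
def vars : PRE A → Finset ℕ
  | zero => ∅
  | epsilon => ∅
  | char _ => ∅
  | union r s => vars r ∪ vars s
  | concat r s => vars r ∪ vars s
  | star r => vars r
  | group r => vars r
  | backref k => {k}

/-- `NonNestedAt V m r`: if a group of `r` has a number in `V`, then no group inside it has a
number in `V` and there is no back reference inside it. Here `r` is a subexpression of a larger
expression in which `m` groups have been opened to the left of `r`. -/
def NonNestedAt (V : Finset ℕ) : ℕ → PRE A → Prop
  | _, zero => True
  | _, epsilon => True
  | _, char _ => True
  | m, union r s => NonNestedAt V m r ∧ NonNestedAt V (m + numGroups r) s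
  | m, concat r s => NonNestedAt V m r ∧ NonNestedAt V (m + numGroups r) s
  | m, star r => NonNestedAt V m r
  | m, group r =>
      (m + 1 ∈ V → (∀ j ∈ V, ¬ (m + 1 < j ∧ j ≤ m + 1 + numGroups r)) ∧ vars r = ∅) ∧
        NonNestedAt V (m + 1) r
  | _, backref _ => True

/-- The variables of an expression are non-nested if no variable occurs, be it defined or
referenced, inside the group that defines a variable. -/
def NonNested (r : PRE A) : Prop := NonNestedAt (vars r) 0 r

/-- `Matches m r σ w τ`: the subexpression `r`, to the left of which `m` groups have been opened,
matches the string `w`, and this changes the values of the groups from `σ` to `τ`. The value of a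
group is the string that the group has matched most recently, and `none` as long as there is no
such string; a reference to a group without a value matches nothing. -/
inductive Matches : ℕ → PRE A → (ℕ → Option (List A)) → List A → (ℕ → Option (List A)) → Prop
  | epsilon (m σ) : Matches m epsilon σ [] σ
  | char (m σ) (a : A) : Matches m (char a) σ [a] σ
  | union_left {m r s σ w τ} : Matches m r σ w τ → Matches m (union r s) σ w τ
  | union_right {m r s σ w τ} :
      Matches (m + numGroups r) s σ w τ → Matches m (union r s) σ w τ
  | concat {m r s σ u ρ v τ} :
      Matches m r σ u ρ → Matches (m + numGroups r) s ρ v τ →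
        Matches m (concat r s) σ (u ++ v) τ
  | star_nil (m r σ) : Matches m (star r) σ [] σ
  | star_cons {m r σ u ρ v τ} :
      Matches m r σ u ρ → Matches m (star r) ρ v τ → Matches m (star r) σ (u ++ v) τ
  | group {m r σ w τ} :
      Matches (m + 1) r σ w τ → Matches m (group r) σ w (Function.update τ (m + 1) (some w))
  | backref {m k σ w} : σ k = some w → Matches m (backref k) σ w σ

/-- The language characterized by an expression. -/
def language (r : PRE A) : Language A := {w | ∃ τ, Matches 0 r (fun _ => none) w τ}

/-- The class of languages over `A` characterized by valid expressions with (at most) `b`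
different variables. -/
def Class (A : Type*) (b : ℕ) : Set (Language A) :=
  {L | ∃ r : PRE A, r.Valid ∧ r.vars.card ≤ b ∧ r.language = L}

/-- The class of languages over `A` characterized by valid expressions with (at most) `b`
different variables, which are non-nested. -/
def NonNestedClass (A : Type*) (b : ℕ) : Set (Language A) :=
  {L | ∃ r : PRE A, r.Valid ∧ r.NonNested ∧ r.vars.card ≤ b ∧ r.language = L}

end PRE

/-- The language of all `w₁ # w₂ # ⋯ # w_b # w_b # ⋯ # w₂ # w₁` with `wᵢ ∈ {zero, one}*`. -/
def mirrorLanguage {A : Type*} (zero one hash : A) (b : ℕ) : Language A :=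
  {x | ∃ ws : List (List A), ws.length = b ∧ (∀ w ∈ ws, ∀ a ∈ w, a = zero ∨ a = one) ∧
    x = [hash].intercalate (ws ++ ws.reverse)}

/-! The upper bound is witnessed by `(w)#(w)#⋯(w)#\b#⋯#\1`, where `w` stands for `(0|1)*`. Since
`NonNestedClass` is contained in `Class` and grows with the bound, the strict inclusion follows from
the statement about `L_b`.

The lower bound is a fooling-set argument. Suppose an expression with at most `b - 1` variables
characterizes `L_b`, and cut a match of a word of `L_b` in the middle. What happens behind the cut
depends only on the place in the syntax tree, an offset if the cut falls inside a letter or back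
reference, and the values still to be read. If two words agree in these data, the first half of one
and the second half of the other form a match (`PrefixMatch.join`), so the hybrid word is in the
language.

There are boundedly many places and linearly many offsets. The point is to bound the values. By
`Valid.exists_cut`, a value needed behind the cut occurs before the cut and again at an occurrence
ending behind it. In the words chosen here, each block consists of `n` free bits between two one-hot
encodings of its number, each of length `b`. Consequently a `#` together with `b` letters on either
side occurs at one position only (`position_unique`). A factor occurring twice therefore has no `#`
except near its ends, and there are only `O(2^n)` such factors (`mem_sparse`,
`exists_card_sparse_lt`).

Hence there are `O(n) * O(2^n)^(b - 1)` configurations, fewer than the `2^(n * b)` words once `n` is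
large. Two words share a configuration, and their hybrid is a word of `L_b` with different halves,
which is impossible (`eq_of_mem_mirrorLanguage`). -/

namespace PRE

variable {A : Type*}

/-! ### Partial stores: monotonicity and pruning -/

/-- `Sub σ τ`: every value defined in `σ` is also the value in `τ`. -/
def Sub (σ τ : ℕ → Option (List A)) : Prop := ∀ k z, σ k = some z → τ k = some z

theorem Sub.refl (σ : ℕ → Option (List A)) : Sub σ σ := fun _ _ h => h

theorem Sub.trans {σ τ ρ : ℕ → Option (List A)} (h : Sub σ τ) (h' : Sub τ ρ) : Sub σ ρ :=
  fun k z hk => h' k z (h k z hk)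

theorem Sub.update {σ τ : ℕ → Option (List A)} (h : Sub σ τ) (k : ℕ) {x y : Option (List A)}
    (hxy : ∀ z, x = some z → y = some z) :
    Sub (Function.update σ k x) (Function.update τ k y) := by
  intro j z hj
  by_cases hk : j = k
  · subst hk
    simp only [Function.update_self] at hj ⊢
    exact hxy z hj
  · simp only [Function.update_of_ne hk] at hj ⊢
    exact h j z hj

/-- A more defined store allows the same matches. -/
theorem Matches.mono {m : ℕ} {r : PRE A} {σ τ : ℕ → Option (List A)} {w : List A}
    (h : Matches m r σ w τ) : ∀ {σ'}, Sub σ σ' → ∃ τ', Sub τ τ' ∧ Matches m r σ' w τ' := by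
  induction h with
  | epsilon m σ => exact fun {σ'} hs => ⟨σ', hs, .epsilon m σ'⟩
  | char m σ a => exact fun {σ'} hs => ⟨σ', hs, .char m σ' a⟩
  | union_left _ ih =>
    intro σ' hs
    obtain ⟨τ', h1, h2⟩ := ih hs
    exact ⟨τ', h1, .union_left h2⟩
  | union_right _ ih =>
    intro σ' hs
    obtain ⟨τ', h1, h2⟩ := ih hs
    exact ⟨τ', h1, .union_right h2⟩
  | concat _ _ ih1 ih2 =>
    intro σ' hs
    obtain ⟨ρ', h1, h2⟩ := ih1 hs
    obtain ⟨τ', h3, h4⟩ := ih2 h1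
    exact ⟨τ', h3, .concat h2 h4⟩
  | star_nil m r σ => exact fun {σ'} hs => ⟨σ', hs, .star_nil m r σ'⟩
  | star_cons _ _ ih1 ih2 =>
    intro σ' hs
    obtain ⟨ρ', h1, h2⟩ := ih1 hs
    obtain ⟨τ', h3, h4⟩ := ih2 h1
    exact ⟨τ', h3, .star_cons h2 h4⟩
  | group _ ih =>
    intro σ' hs
    obtain ⟨τ', h1, h2⟩ := ih hs
    exact ⟨_, h1.update _ fun _ h => h, .group h2⟩
  | backref hk => exact fun {σ'} hs => ⟨σ', hs, .backref (hs _ _ hk)⟩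

/-- Values that are neither referenced during a match nor wanted after it can be dropped. -/
theorem Matches.prune {m : ℕ} {r : PRE A} {σ τ : ℕ → Option (List A)} {w : List A}
    (h : Matches m r σ w τ) : ∀ {τ₀}, Sub τ₀ τ → ∃ σ₀ τ₁, Sub σ₀ σ ∧ Sub τ₀ τ₁ ∧
      Matches m r σ₀ w τ₁ ∧
      ∀ k z, σ₀ k = some z → τ₀ k = some z ∨ (k ∈ vars r ∧ z <:+: w) := by
  induction h with
  | epsilon m σ => exact fun {τ₀} hs => ⟨τ₀, τ₀, hs, .refl _, .epsilon m τ₀, fun _ _ h => .inl h⟩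
  | char m σ a => exact fun {τ₀} hs => ⟨τ₀, τ₀, hs, .refl _, .char m τ₀ a, fun _ _ h => .inl h⟩
  | union_left _ ih =>
    intro τ₀ hs
    obtain ⟨σ₀, τ₁, h1, h2, h3, h4⟩ := ih hs
    refine ⟨σ₀, τ₁, h1, h2, .union_left h3, fun k z hk => (h4 k z hk).imp_right fun h => ?_⟩
    exact ⟨Finset.mem_union_left _ h.1, h.2⟩
  | union_right _ ih =>
    intro τ₀ hs
    obtain ⟨σ₀, τ₁, h1, h2, h3, h4⟩ := ih hs
    refine ⟨σ₀, τ₁, h1, h2, .union_right h3, fun k z hk => (h4 k z hk).imp_right fun h => ?_⟩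
    exact ⟨Finset.mem_union_right _ h.1, h.2⟩
  | concat _ _ ih1 ih2 =>
    intro τ₀ hs
    obtain ⟨ρ₀, τ₁, h1, h2, h3, h4⟩ := ih2 hs
    obtain ⟨σ₀, ρ₁, h5, h6, h7, h8⟩ := ih1 h1
    obtain ⟨τ₂, h9, h10⟩ := h3.mono h6
    refine ⟨σ₀, τ₂, h5, h2.trans h9, .concat h7 h10, fun k z hk => ?_⟩
    rcases h8 k z hk with h | h
    · exact (h4 k z h).imp_right fun h =>
        ⟨Finset.mem_union_right _ h.1, h.2.trans (List.suffix_append _ _).isInfix⟩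
    · exact .inr ⟨Finset.mem_union_left _ h.1, h.2.trans (List.prefix_append _ _).isInfix⟩
  | star_nil m r σ =>
    exact fun {τ₀} hs => ⟨τ₀, τ₀, hs, .refl _, .star_nil m r τ₀, fun _ _ h => .inl h⟩
  | star_cons _ _ ih1 ih2 =>
    intro τ₀ hs
    obtain ⟨ρ₀, τ₁, h1, h2, h3, h4⟩ := ih2 hs
    obtain ⟨σ₀, ρ₁, h5, h6, h7, h8⟩ := ih1 h1
    obtain ⟨τ₂, h9, h10⟩ := h3.mono h6
    refine ⟨σ₀, τ₂, h5, h2.trans h9, .star_cons h7 h10, fun k z hk => ?_⟩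
    rcases h8 k z hk with h | h
    · exact (h4 k z h).imp_right fun h => ⟨h.1, h.2.trans (List.suffix_append _ _).isInfix⟩
    · exact .inr ⟨h.1, h.2.trans (List.prefix_append _ _).isInfix⟩
  | @group m r σ w τ _ ih =>
    intro τ₀ hs
    -- The group itself writes number `m + 1`, so a demand for this value afterwards is no demand on
    -- its body.
    have hs' : Sub (Function.update τ₀ (m + 1) none) τ := by
      intro k z hk
      by_cases hkm : k = m + 1
      · simp [hkm] at hk
      · rw [Function.update_of_ne hkm] at hk
        simpa [Function.update_of_ne hkm] using hs k z hk
    obtain ⟨σ₀, τ₁, h1, h2, h3, h4⟩ := ih hs'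
    refine ⟨σ₀, _, h1, ?_, .group h3, fun k z hk => (h4 k z hk).imp_left fun h => ?_⟩
    · intro k z hk
      by_cases hkm : k = m + 1
      · subst hkm
        simpa using hs _ z hk
      · rw [Function.update_of_ne hkm]
        exact h2 k z (by rwa [Function.update_of_ne hkm])
    · by_cases hkm : k = m + 1
      · simp [hkm] at h
      · rwa [Function.update_of_ne hkm] at h
  | @backref m k σ w hk =>
    intro τ₀ hs
    -- The reference adds its own value to the demand; this is consistent because `τ₀` is below a
    -- store with value `w` at `k`.
    refine ⟨Function.update τ₀ k (some w), Function.update τ₀ k (some w), ?_, ?_,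
      .backref (by simp), ?_⟩
    · intro j z hj
      by_cases hjk : j = k
      · subst hjk
        simpa [hk] using hj
      · rw [Function.update_of_ne hjk] at hj
        exact hs j z hj
    · intro j z hj
      by_cases hjk : j = k
      · subst hjk
        have := hs j z hj
        simp_all
      · rwa [Function.update_of_ne hjk]
    · intro j z hj
      by_cases hjk : j = k
      · subst hjk
        right
        simp only [Function.update_self, Option.some.injEq] at hj
        simp [vars, hj]
      · rw [Function.update_of_ne hjk] at hj
        exact .inl hj

/-! ### Cutting a match and rejoining it -/

/-- `PrefixMatch m r π j σ u ρ`: `u` is the part of a match of `r` up to the cut which is given by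
the path `π` to a subexpression and an offset `j`. The value in `ρ` of a group that is still open
is the string it has matched so far. -/
inductive PrefixMatch : ℕ → PRE A → List Bool → ℕ → (ℕ → Option (List A)) → List A →
    (ℕ → Option (List A)) → Prop
  | atEnd {m r σ u ρ} : Matches m r σ u ρ → PrefixMatch m r [] 0 σ u ρ
  | char (m a σ) : PrefixMatch m (char a) [] 1 σ [] σ
  | backref {m k σ y z} : σ k = some (y ++ z) →
      PrefixMatch m (backref k) [] (y.length + 1) σ y σ
  | union_left {m r s π j σ u ρ} : PrefixMatch m r π j σ u ρ →
      PrefixMatch m (union r s) (false :: π) j σ u ρ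
  | union_right {m r s π j σ u ρ} : PrefixMatch (m + numGroups r) s π j σ u ρ →
      PrefixMatch m (union r s) (true :: π) j σ u ρ
  | concat_left {m r s π j σ u ρ} : PrefixMatch m r π j σ u ρ →
      PrefixMatch m (concat r s) (false :: π) j σ u ρ
  | concat_right {m r s π j σ w τ u ρ} : Matches m r σ w τ →
      PrefixMatch (m + numGroups r) s π j τ u ρ →
      PrefixMatch m (concat r s) (true :: π) j σ (w ++ u) ρ
  | star_here {m r π j σ u ρ} : PrefixMatch m r π j σ u ρ →
      PrefixMatch m (star r) (true :: π) j σ u ρ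
  | star_later {m r π j σ w τ u ρ} : Matches m r σ w τ → PrefixMatch m (star r) π j τ u ρ →
      PrefixMatch m (star r) π j σ (w ++ u) ρ
  | group {m r π j σ u ρ} : PrefixMatch (m + 1) r π j σ u ρ →
      PrefixMatch m (group r) (true :: π) j σ u (Function.update ρ (m + 1) (some u))

/-- `SuffixMatch m r π j ρ v τ`: `v` is the part of a match of `r` from the cut given by `π` and
`j` onwards. The value of an open group may be missing; it remains so when the group is closed. -/
inductive SuffixMatch : ℕ → PRE A → List Bool → ℕ → (ℕ → Option (List A)) → List A →
    (ℕ → Option (List A)) → Prop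
  | atEnd (m r ρ) : SuffixMatch m r [] 0 ρ [] ρ
  | char (m a ρ) : SuffixMatch m (char a) [] 1 ρ [a] ρ
  | backref {m k ρ y z} : ρ k = some (y ++ z) →
      SuffixMatch m (backref k) [] (y.length + 1) ρ z ρ
  | union_left {m r s π j ρ v τ} : SuffixMatch m r π j ρ v τ →
      SuffixMatch m (union r s) (false :: π) j ρ v τ
  | union_right {m r s π j ρ v τ} : SuffixMatch (m + numGroups r) s π j ρ v τ →
      SuffixMatch m (union r s) (true :: π) j ρ v τ
  | concat_left {m r s π j ρ v τ w τ'} : SuffixMatch m r π j ρ v τ →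
      Matches (m + numGroups r) s τ w τ' →
      SuffixMatch m (concat r s) (false :: π) j ρ (v ++ w) τ'
  | concat_right {m r s π j ρ v τ} : SuffixMatch (m + numGroups r) s π j ρ v τ →
      SuffixMatch m (concat r s) (true :: π) j ρ v τ
  | star {m r π j ρ v τ w τ'} : SuffixMatch m r π j ρ v τ → Matches m (star r) τ w τ' →
      SuffixMatch m (star r) (true :: π) j ρ (v ++ w) τ'
  | group {m r π j ρ v τ} : SuffixMatch (m + 1) r π j (Function.update ρ (m + 1) none) v τ →
      SuffixMatch m (group r) (true :: π) j ρ v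
        (Function.update τ (m + 1) ((ρ (m + 1)).map (· ++ v)))

/-- A match up to a cut and a match from the same cut onwards can be put together. -/
theorem PrefixMatch.join {m : ℕ} {r : PRE A} {π : List Bool} {j : ℕ}
    {σ ρ : ℕ → Option (List A)} {u : List A} (h : PrefixMatch m r π j σ u ρ) :
    ∀ {ρ₀ v τ}, SuffixMatch m r π j ρ₀ v τ → Sub ρ₀ ρ →
      ∃ τ', Sub τ τ' ∧ Matches m r σ (u ++ v) τ' := by
  induction h with
  | atEnd h =>
    intro ρ₀ v τ h' hs
    cases h'
    exact ⟨_, hs, by simpa using h⟩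
  | char m a σ =>
    intro ρ₀ v τ h' hs
    cases h'
    exact ⟨_, hs, .char m σ a⟩
  | @backref m k σ y z hk =>
    intro ρ₀ v τ h' hs
    generalize hj : y.length + 1 = j at h'
    cases h' with
    | atEnd => omega
    | @backref _ _ _ y' z' hk' =>
      have h1 := hs _ _ hk'
      rw [hk, Option.some.injEq] at h1
      -- Both sides split the same value, and the common offset makes them split it at the same
      -- point.
      obtain ⟨rfl, rfl⟩ := List.append_inj h1 (by omega)
      exact ⟨_, hs, .backref hk⟩
  | union_left _ ih =>
    intro ρ₀ v τ h' hs
    cases h' with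
    | union_left h' =>
      obtain ⟨τ', h1, h2⟩ := ih h' hs
      exact ⟨τ', h1, .union_left h2⟩
  | union_right _ ih =>
    intro ρ₀ v τ h' hs
    cases h' with
    | union_right h' =>
      obtain ⟨τ', h1, h2⟩ := ih h' hs
      exact ⟨τ', h1, .union_right h2⟩
  | concat_left _ ih =>
    intro ρ₀ v τ h' hs
    cases h' with
    | concat_left h' hm =>
      obtain ⟨τ', h1, h2⟩ := ih h' hs
      obtain ⟨τ'', h3, h4⟩ := hm.mono h1
      exact ⟨τ'', h3, by rw [← List.append_assoc]; exact .concat h2 h4⟩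
  | concat_right hm _ ih =>
    intro ρ₀ v τ h' hs
    cases h' with
    | concat_right h' =>
      obtain ⟨τ', h1, h2⟩ := ih h' hs
      exact ⟨τ', h1, by rw [List.append_assoc]; exact .concat hm h2⟩
  | star_here _ ih =>
    intro ρ₀ v τ h' hs
    cases h' with
    | star h' hm =>
      obtain ⟨τ', h1, h2⟩ := ih h' hs
      obtain ⟨τ'', h3, h4⟩ := hm.mono h1
      exact ⟨τ'', h3, by rw [← List.append_assoc]; exact .star_cons h2 h4⟩
  | star_later hm _ ih =>
    intro ρ₀ v τ h' hs
    obtain ⟨τ', h1, h2⟩ := ih h' hs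
    exact ⟨τ', h1, by rw [List.append_assoc]; exact .star_cons hm h2⟩
  | @group m r π j σ u ρ _ ih =>
    intro ρ₀ v τ h' hs
    cases h' with
    | group h' =>
      obtain ⟨τ', h1, h2⟩ := ih h' (by
        intro k z hk
        by_cases hkm : k = m + 1
        · simp [hkm] at hk
        · rw [Function.update_of_ne hkm] at hk
          simpa [Function.update_of_ne hkm] using hs k z hk)
      refine ⟨_, h1.update _ ?_, .group h2⟩
      -- If `ρ₀` records a value for the open group, it is the string `u` read so far, so appending
      -- `v` gives the true value at closing.
      intro z hz
      obtain ⟨y, hy, rfl⟩ := Option.map_eq_some_iff.1 hz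
      simpa using hs _ _ hy

/-- No reference to an open group occurs in a valid expression. -/
theorem ValidAt.notMem_vars {r : PRE A} {k : ℕ} :
    ∀ {m : ℕ} {O : Finset ℕ}, ValidAt m O r → k ∈ O → k ∉ vars r := by
  induction r with
  | zero | epsilon | char a => intros; simp [vars]
  | union r s ihr ihs | concat r s ihr ihs =>
    intro m O h hk
    simpa [vars] using ⟨ihr h.1 hk, ihs h.2 hk⟩
  | star r ih => exact fun h hk => ih (m := _) h hk
  | group r ih => exact fun h hk => ih (m := _ + 1) h (Finset.mem_insert_of_mem hk)
  | backref j =>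
    intro m O h hk hj
    rw [vars, Finset.mem_singleton] at hj
    exact h.2.2 (hj ▸ hk)

/-- `z` occurs in `u ++ v` so that it ends in `v`. -/
def OccursBeyond (u v z : List A) : Prop :=
  z <:+: v ∨ ∃ y y', z = y ++ y' ∧ y' ≠ [] ∧ y <:+ u ∧ y' <+: v

theorem OccursBeyond.append_left {u v z : List A} (h : OccursBeyond u v z) (w : List A) :
    OccursBeyond (w ++ u) v z := by
  rcases h with h | ⟨y, y', h1, h2, h3, h4⟩
  · exact .inl h
  · exact .inr ⟨y, y', h1, h2, h3.trans (List.suffix_append _ _), h4⟩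

theorem OccursBeyond.append_right {u v z : List A} (h : OccursBeyond u v z) (w : List A) :
    OccursBeyond u (v ++ w) z := by
  rcases h with h | ⟨y, y', h1, h2, h3, h4⟩
  · exact .inl (h.trans (List.prefix_append _ _).isInfix)
  · exact .inr ⟨y, y', h1, h2, h3, h4.trans (List.prefix_append _ _)⟩

/-- A match can be cut at any point, and behind the cut only those values are needed that are
referenced or wanted afterwards. -/
theorem Matches.cut {m : ℕ} {r : PRE A} {σ τ : ℕ → Option (List A)} {w : List A}
    (h : Matches m r σ w τ) : ∀ {O u v τ₀}, ValidAt m O r → w = u ++ v → Sub τ₀ τ →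
      ∃ π j ρ ρ₀ τ₁, PrefixMatch m r π j σ u ρ ∧ Sub ρ₀ ρ ∧ SuffixMatch m r π j ρ₀ v τ₁ ∧
        Sub τ₀ τ₁ ∧ ∀ k z, ρ₀ k = some z →
          (∃ z', τ₀ k = some z' ∧ z <+: z') ∨ (k ∈ vars r ∧ OccursBeyond u v z) := by
  induction h with
  | epsilon m σ =>
    intro O u v τ₀ _ hw hs
    obtain ⟨rfl, rfl⟩ := List.append_eq_nil_iff.1 hw.symm
    exact ⟨[], 0, σ, τ₀, τ₀, .atEnd (.epsilon m σ), hs, .atEnd _ _ _, .refl _,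
      fun k z hk => .inl ⟨z, hk, List.prefix_rfl⟩⟩
  | char m σ a =>
    intro O u v τ₀ _ hw hs
    rcases List.append_eq_singleton_iff.1 hw.symm with ⟨rfl, rfl⟩ | ⟨rfl, rfl⟩
    · exact ⟨[], 1, σ, τ₀, τ₀, .char m a σ, hs, .char _ _ _, .refl _,
        fun k z hk => .inl ⟨z, hk, List.prefix_rfl⟩⟩
    · exact ⟨[], 0, σ, τ₀, τ₀, .atEnd (.char m σ a), hs, .atEnd _ _ _, .refl _,
        fun k z hk => .inl ⟨z, hk, List.prefix_rfl⟩⟩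
  | union_left _ ih =>
    intro O u v τ₀ hv hw hs
    obtain ⟨π, j, ρ, ρ₀, τ₁, h1, h2, h3, h4, h5⟩ := ih hv.1 hw hs
    exact ⟨_, j, ρ, ρ₀, τ₁, .union_left h1, h2, .union_left h3, h4, fun k z hk =>
      (h5 k z hk).imp_right fun h => ⟨Finset.mem_union_left _ h.1, h.2⟩⟩
  | union_right _ ih =>
    intro O u v τ₀ hv hw hs
    obtain ⟨π, j, ρ, ρ₀, τ₁, h1, h2, h3, h4, h5⟩ := ih hv.2 hw hs
    exact ⟨_, j, ρ, ρ₀, τ₁, .union_right h1, h2, .union_right h3, h4, fun k z hk =>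
      (h5 k z hk).imp_right fun h => ⟨Finset.mem_union_right _ h.1, h.2⟩⟩
  | concat hm hm' ih ih' =>
    intro O u v τ₀ hv hw hs
    rcases List.append_eq_append_iff.1 hw with ⟨c, rfl, rfl⟩ | ⟨c, rfl, rfl⟩
    · obtain ⟨π, j, ρ, ρ₀, τ₁, h1, h2, h3, h4, h5⟩ := ih' hv.2 rfl hs
      exact ⟨_, j, ρ, ρ₀, τ₁, .concat_right hm h1, h2, .concat_right h3, h4, fun k z hk =>
        (h5 k z hk).imp_right fun h =>
          ⟨Finset.mem_union_right _ h.1, h.2.append_left _⟩⟩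
    -- The demand travels backwards: what the uncut right factor needs is what is wanted after the
    -- left factor.
    · obtain ⟨ρ₀', τ₁', g1, g2, g3, g4⟩ := hm'.prune hs
      obtain ⟨π, j, ρ, ρ₀, τ₁, h1, h2, h3, h4, h5⟩ := ih hv.1 rfl g1
      obtain ⟨τ₂, g5, g6⟩ := g3.mono h4
      refine ⟨_, j, ρ, ρ₀, τ₂, .concat_left h1, h2, .concat_left h3 g6, g2.trans g5,
        fun k z hk => ?_⟩
      rcases h5 k z hk with ⟨z', h, hz⟩ | h
      · rcases g4 k z' h with h | h
        · exact .inl ⟨z', h, hz⟩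
        · exact .inr ⟨Finset.mem_union_right _ h.1,
            .inl ((hz.isInfix.trans h.2).trans (List.suffix_append _ _).isInfix)⟩
      · exact .inr ⟨Finset.mem_union_left _ h.1, h.2.append_right _⟩
  | star_nil m r σ =>
    intro O u v τ₀ _ hw hs
    obtain ⟨rfl, rfl⟩ := List.append_eq_nil_iff.1 hw.symm
    exact ⟨[], 0, σ, τ₀, τ₀, .atEnd (.star_nil m r σ), hs, .atEnd _ _ _, .refl _,
      fun k z hk => .inl ⟨z, hk, List.prefix_rfl⟩⟩
  | star_cons hm hm' ih ih' =>
    intro O u v τ₀ hv hw hs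
    rcases List.append_eq_append_iff.1 hw with ⟨c, rfl, rfl⟩ | ⟨c, rfl, rfl⟩
    · obtain ⟨π, j, ρ, ρ₀, τ₁, h1, h2, h3, h4, h5⟩ := ih' hv rfl hs
      exact ⟨_, j, ρ, ρ₀, τ₁, .star_later hm h1, h2, h3, h4, fun k z hk =>
        (h5 k z hk).imp_right fun h => ⟨h.1, h.2.append_left _⟩⟩
    · obtain ⟨ρ₀', τ₁', g1, g2, g3, g4⟩ := hm'.prune hs
      obtain ⟨π, j, ρ, ρ₀, τ₁, h1, h2, h3, h4, h5⟩ := ih hv rfl g1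
      obtain ⟨τ₂, g5, g6⟩ := g3.mono h4
      refine ⟨_, j, ρ, ρ₀, τ₂, .star_here h1, h2, .star h3 g6, g2.trans g5, fun k z hk => ?_⟩
      rcases h5 k z hk with ⟨z', h, hz⟩ | h
      · rcases g4 k z' h with h | h
        · exact .inl ⟨z', h, hz⟩
        · exact .inr ⟨h.1, .inl ((hz.isInfix.trans h.2).trans (List.suffix_append _ _).isInfix)⟩
      · exact .inr ⟨h.1, h.2.append_right _⟩
  | @group m r σ w τ _ ih =>
    intro O u v τ₀ hv hw hs
    have hs' : Sub (Function.update τ₀ (m + 1) none) τ := by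
      intro k z hk
      by_cases hkm : k = m + 1
      · simp [hkm] at hk
      · rw [Function.update_of_ne hkm] at hk
        simpa [Function.update_of_ne hkm] using hs k z hk
    obtain ⟨π, j, ρ, ρ₀, τ₁, h1, h2, h3, h4, h5⟩ := ih (O := insert (m + 1) O) hv hw hs'
    -- Validity forbids references to the open group inside its body, and its old value is not
    -- wanted at the end, so nothing asks for it.
    have hnone : ρ₀ (m + 1) = none := by
      by_contra hne
      obtain ⟨z, hz⟩ := Option.ne_none_iff_exists'.1 hne
      rcases h5 _ z hz with ⟨z', h, -⟩ | h
      · simp at h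
      · exact ValidAt.notMem_vars (m := m + 1) hv (Finset.mem_insert_self _ _) h.1
    -- If the final value of the group is wanted, the part `u` read before the cut must be
    -- remembered; it is a prefix of that final value.
    refine ⟨_, j, _, Function.update ρ₀ (m + 1) ((τ₀ (m + 1)).map fun _ => u), _, .group h1,
      h2.update _ ?_, .group (τ := τ₁) ?_, ?_, ?_⟩
    · intro z hz
      obtain ⟨y, hy, rfl⟩ := Option.map_eq_some_iff.1 hz
      rfl
    · rw [Function.update_idem, ← hnone, Function.update_eq_self]
      exact h3
    · intro k z hk
      by_cases hkm : k = m + 1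
      · subst hkm
        have := hs _ z hk
        simp only [Function.update_self, Option.some.injEq] at this
        simp [hk, ← this, hw]
      · rw [Function.update_of_ne hkm]
        exact h4 k z (by rwa [Function.update_of_ne hkm])
    · intro k z hk
      by_cases hkm : k = m + 1
      · subst hkm
        simp only [Function.update_self, Option.map_eq_some_iff] at hk
        obtain ⟨y, hy, rfl⟩ := hk
        have := hs _ y hy
        simp only [Function.update_self, Option.some.injEq] at this
        exact .inl ⟨y, hy, by rw [← this, hw]; exact List.prefix_append _ _⟩
      · rw [Function.update_of_ne hkm] at hk
        simpa [vars, Function.update_of_ne hkm] using h5 k z hk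
  | @backref m k σ w hk =>
    intro O u v τ₀ _ hw hs
    -- A cut at the end of the reference is recorded as `atEnd` and demands no value. Only this
    -- makes every demanded occurrence end strictly behind the cut.
    by_cases hvn : v = []
    · subst hvn
      rw [List.append_nil] at hw
      subst hw
      exact ⟨[], 0, σ, τ₀, τ₀, .atEnd (.backref hk), hs, .atEnd _ _ _, .refl _,
        fun k z hk => .inl ⟨z, hk, List.prefix_rfl⟩⟩
    · subst hw
      refine ⟨[], u.length + 1, σ, Function.update τ₀ k (some (u ++ v)), _, .backref hk, ?_,
        .backref (y := u) (by simp), ?_, ?_⟩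
      · intro i z hi
        by_cases hik : i = k
        · subst hik
          simpa [hk] using hi
        · rw [Function.update_of_ne hik] at hi
          exact hs i z hi
      · intro i z hi
        by_cases hik : i = k
        · subst hik
          have := hs i z hi
          simp_all
        · rwa [Function.update_of_ne hik]
      · intro i z hi
        by_cases hik : i = k
        · subst hik
          simp only [Function.update_self, Option.some.injEq] at hi
          exact .inr ⟨by simp [vars], .inr ⟨u, v, hi.symm, hvn, List.suffix_rfl, List.prefix_rfl⟩⟩
        · rw [Function.update_of_ne hik] at hi
          exact .inl ⟨z, hi, List.prefix_rfl⟩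

/-- The values of the groups are infixes of what has been read. -/
theorem Matches.isInfix {m : ℕ} {r : PRE A} {σ τ : ℕ → Option (List A)} {w : List A}
    (h : Matches m r σ w τ) : ∀ {p : List A}, (∀ k z, σ k = some z → z <:+: p) →
      ∀ k z, τ k = some z → z <:+: p ++ w := by
  induction h with
  | epsilon | star_nil => simp
  | char | backref =>
    exact fun hp k z hk => (hp k z hk).trans (List.prefix_append _ _).isInfix
  | union_left _ ih | union_right _ ih => exact ih
  | concat _ _ ih ih' | star_cons _ _ ih ih' =>
    intro p hp
    rw [← List.append_assoc]
    exact ih' (ih hp)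
  | @group m r σ w τ _ ih =>
    intro p hp k z hk
    by_cases hkm : k = m + 1
    · subst hkm
      simp only [Function.update_self, Option.some.injEq] at hk
      exact hk ▸ (List.suffix_append _ _).isInfix
    · rw [Function.update_of_ne hkm] at hk
      exact ih hp k z hk

theorem PrefixMatch.isInfix {m : ℕ} {r : PRE A} {π : List Bool} {j : ℕ}
    {σ ρ : ℕ → Option (List A)} {u : List A} (h : PrefixMatch m r π j σ u ρ) :
    ∀ {p : List A}, (∀ k z, σ k = some z → z <:+: p) → ∀ k z, ρ k = some z → z <:+: p ++ u := by
  induction h with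
  | atEnd h => exact h.isInfix
  | char | backref =>
    exact fun hp k z hk => (hp k z hk).trans (List.prefix_append _ _).isInfix
  | union_left _ ih | union_right _ ih | concat_left _ ih | star_here _ ih => exact ih
  | concat_right hm _ ih | star_later hm _ ih =>
    intro p hp
    rw [← List.append_assoc]
    exact ih (hm.isInfix hp)
  | @group m r π j σ u ρ _ ih =>
    intro p hp k z hk
    by_cases hkm : k = m + 1
    · subst hkm
      simp only [Function.update_self, Option.some.injEq] at hk
      exact hk ▸ (List.suffix_append _ _).isInfix
    · rw [Function.update_of_ne hkm] at hk
      exact ih hp k z hk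

/-- Bounds the number of possible offsets linearly in the length of the word. -/
theorem PrefixMatch.offset_le {m : ℕ} {r : PRE A} {π : List Bool} {j : ℕ}
    {σ ρ : ℕ → Option (List A)} {u : List A} (h : PrefixMatch m r π j σ u ρ) :
    j ≤ u.length + 1 := by
  induction h with
  | atEnd | char | backref => simp
  | union_left _ ih | union_right _ ih | concat_left _ ih | star_here _ ih | group _ ih => exact ih
  | concat_right _ _ ih | star_later _ _ ih =>
    rw [List.length_append]
    omega

/-- The height of the syntax tree. -/
def height : PRE A → ℕ
  | zero => 0
  | epsilon => 0
  | char _ => 0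
  | union r s => max (height r) (height s) + 1
  | concat r s => max (height r) (height s) + 1
  | star r => height r + 1
  | group r => height r + 1
  | backref _ => 0

/-- A path records a place in the syntax tree but not the number of completed iterations of a star,
so the number of paths depends on the expression alone. -/
theorem PrefixMatch.length_path_le {m : ℕ} {r : PRE A} {π : List Bool} {j : ℕ}
    {σ ρ : ℕ → Option (List A)} {u : List A} (h : PrefixMatch m r π j σ u ρ) :
    π.length ≤ height r := by
  induction h with
  | atEnd | char | backref => simp
  | star_later _ _ ih => exact ih
  | union_left _ ih | union_right _ ih | concat_left _ ih | concat_right _ _ ih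
  | star_here _ ih | group _ ih =>
    simp only [List.length_cons, height]
    omega

/-- The data at a cut of a match of a valid expression: the cut and the values of the variables
needed behind it, all of which occur before the cut and once more, ending behind the cut. -/
theorem Valid.exists_cut {r : PRE A} (hr : r.Valid) {u v : List A} (h : u ++ v ∈ r.language) :
    ∃ π j ρ ρ₀ τ, PrefixMatch 0 r π j (fun _ => none) u ρ ∧ Sub ρ₀ ρ ∧
      SuffixMatch 0 r π j ρ₀ v τ ∧
      ∀ k z, ρ₀ k = some z → k ∈ vars r ∧ z <:+: u ∧ OccursBeyond u v z := by
  obtain ⟨τ, h⟩ := h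
  obtain ⟨π, j, ρ, ρ₀, τ₁, h1, h2, h3, -, h5⟩ :=
    h.cut (τ₀ := fun _ => none) hr rfl (fun _ _ h => by cases h)
  refine ⟨π, j, ρ, ρ₀, τ₁, h1, h2, h3, fun k z hk => ?_⟩
  rcases h5 k z hk with ⟨z', h, -⟩ | h
  · cases h
  · exact ⟨h.1, by simpa using h1.isInfix (p := []) (by simp) k z (h2 k z hk), h.2⟩

end PRE

/-! ### Counting and concatenating lists -/

/-- The lists of length at most `n` with entries in `s`. -/
noncomputable def Finset.listsUpTo {α : Type*} (s : Finset α) : ℕ → Finset (List α)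
  | 0 => {[]}
  | n + 1 => by
    classical
    exact insert [] ((s ×ˢ s.listsUpTo n).image fun p => p.1 :: p.2)

theorem Finset.mem_listsUpTo {α : Type*} {s : Finset α} {l : List α} (hl : ∀ a ∈ l, a ∈ s) :
    ∀ {n : ℕ}, l.length ≤ n → l ∈ s.listsUpTo n := by
  classical
  induction l with
  | nil => intro n _; cases n <;> simp [listsUpTo]
  | cons a l ih =>
    intro n hn
    cases n with
    | zero => simp at hn
    | succ n =>
      rw [listsUpTo]
      refine Finset.mem_insert_of_mem (Finset.mem_image.2 ⟨(a, l), ?_, rfl⟩)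
      exact Finset.mem_product.2 ⟨hl a List.mem_cons_self,
        ih (fun b hb => hl b (List.mem_cons_of_mem _ hb)) (by simpa using hn)⟩

theorem Finset.card_listsUpTo_lt {α : Type*} {s : Finset α} (hs : s.card ≤ 2) (n : ℕ) :
    (s.listsUpTo n).card < 2 ^ (n + 1) := by
  classical
  induction n with
  | zero => simp [listsUpTo]
  | succ n ih =>
    have h1 : (s.listsUpTo (n + 1)).card ≤ s.card * (s.listsUpTo n).card + 1 := by
      rw [listsUpTo, ← Finset.card_product]
      exact (Finset.card_insert_le _ _).trans (Nat.succ_le_succ Finset.card_image_le)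
    have h2 := Nat.mul_le_mul_right (s.listsUpTo n).card hs
    rw [pow_succ]
    omega

theorem List.intercalate_append_self {α : Type*} (s : List α) {L : List (List α)} (h : L ≠ []) :
    s.intercalate L ++ s = L.flatMap (· ++ s) := by
  induction L with
  | nil => exact absurd rfl h
  | cons a L ih =>
    cases L with
    | nil => simp [List.intercalate]
    | cons b L =>
      rw [List.flatMap_cons, ← ih (by simp)]
      simp [List.intercalate]

theorem List.intercalate_append {α : Type*} (s : List α) (L : List (List α)) {L' : List (List α)}
    (h : L' ≠ []) : s.intercalate (L ++ L') = L.flatMap (· ++ s) ++ s.intercalate L' := by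
  have h1 := List.intercalate_append_self s (L := L ++ L') (by simp [h])
  rw [List.flatMap_append, ← List.intercalate_append_self s h, ← List.append_assoc] at h1
  exact List.append_cancel_right h1

/-- Position `t` lies in the block `t / (l + 1)` at the place `t % (l + 1)`, the last place being
the separator. -/
theorem List.flatMap_range_eq {α : Type*} (g : ℕ → ℕ → α) (c : α) (l K : ℕ) :
    ((List.range K).flatMap fun k => (List.range l).map (g k) ++ [c]) =
      (List.range (K * (l + 1))).map fun t =>
        if t % (l + 1) = l then c else g (t / (l + 1)) (t % (l + 1)) := by
  induction K with
  | zero => simp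
  | succ K ih =>
    rw [List.range_succ, List.flatMap_append, ih, Nat.succ_mul, List.range_add, List.map_append,
      List.append_cancel_left_eq, List.range_succ]
    simp only [List.flatMap_cons, List.flatMap_nil, List.append_nil, List.map_append,
      List.map_map, List.map_cons, List.map_nil]
    congr 1
    · refine List.map_congr_left fun r hr => ?_
      have hr := List.mem_range.1 hr
      have h1 : (K * (l + 1) + r) % (l + 1) = r := by
        exact Nat.mul_add_mod_of_lt (by omega)
      have h2 : (K * (l + 1) + r) / (l + 1) = K := by
        rw [Nat.mul_comm, Nat.mul_add_div (by omega), Nat.div_eq_of_lt (by omega), Nat.add_zero]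
      simp only [Function.comp_apply, h1, h2]
      rw [if_neg (by omega)]
    · simp

/-! ### The mirror words and their repeated factors -/

namespace MirrorWord

variable {A : Type*} (zero one hash : A) (b n : ℕ)

/-- The `r`-th letter of the block with number `i`: its first and its last `b` letters determine
`i`, and the letters between them are given by `y i`. -/
def letter (y : ℕ → ℕ → Bool) (i r : ℕ) : A :=
  if (if r < b then r = i else if r < b + n then y i (r - b) = true else r = b + n + i)
  then one else zero

/-- The block with number `i`. -/
def block (y : ℕ → ℕ → Bool) (i : ℕ) : List A :=
  (List.range (b + n + b)).map (letter zero one b n y i)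

/-- The blocks. -/
def blocks (y : ℕ → ℕ → Bool) : List (List A) :=
  (List.range b).map (block zero one b n y)

/-- The number of the block at place `k` in the mirror word. -/
def index (k : ℕ) : ℕ := if k < b then k else 2 * b - 1 - k

/-- The letter at the position `t` of the mirror word. -/
def charAt (y : ℕ → ℕ → Bool) (t : ℕ) : A :=
  if t % (b + n + b + 1) = b + n + b then hash
  else letter zero one b n y (index b (t / (b + n + b + 1))) (t % (b + n + b + 1))

/-- The first half of the mirror word. -/
def front (y : ℕ → ℕ → Bool) : List A := (blocks zero one b n y).flatMap (· ++ [hash])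

/-- The second half of the mirror word. -/
def back (y : ℕ → ℕ → Bool) : List A := [hash].intercalate (blocks zero one b n y).reverse

variable {zero one hash b n}

theorem blocks_append_reverse (y : ℕ → ℕ → Bool) :
    blocks zero one b n y ++ (blocks zero one b n y).reverse =
      (List.range (2 * b)).map fun k => block zero one b n y (index b k) := by
  refine List.ext_getElem (by simp [blocks]; omega) fun k h1 h2 => ?_
  simp only [List.length_map, List.length_range] at h2
  by_cases hk : k < b
  · rw [List.getElem_append_left (by simpa [blocks])]
    simp [blocks, index, hk]
  · rw [List.getElem_append_right (by simpa [blocks] using hk)]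
    simp only [blocks, List.getElem_reverse, List.getElem_map, List.getElem_range,
      List.length_map, List.length_range, index, if_neg hk]
    congr 1
    omega

theorem blocks_ne_nil (hb : 0 < b) (y : ℕ → ℕ → Bool) : blocks zero one b n y ≠ [] := by
  simpa [blocks] using hb.ne'

theorem front_append_back (hb : 0 < b) (y y' : ℕ → ℕ → Bool) :
    front zero one hash b n y ++ back zero one hash b n y' =
      [hash].intercalate (blocks zero one b n y ++ (blocks zero one b n y').reverse) :=
  (List.intercalate_append _ _ (by simpa using blocks_ne_nil hb y')).symm

/-- The additional final `hash` gives every block the same period `b + n + b + 1`, so that positions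
can be handled by division with remainder. -/
theorem front_append_back_append (hb : 0 < b) (y : ℕ → ℕ → Bool) :
    front zero one hash b n y ++ back zero one hash b n y ++ [hash] =
      (List.range (2 * b * (b + n + b + 1))).map (charAt zero one hash b n y) := by
  rw [front_append_back hb, List.intercalate_append_self _ (by simp [blocks_ne_nil hb]),
    blocks_append_reverse, List.flatMap_map]
  exact List.flatMap_range_eq (fun k r => letter zero one b n y (index b k) r) hash _ _

theorem length_front_add (hb : 0 < b) (y : ℕ → ℕ → Bool) :
    (front zero one hash b n y).length + (back zero one hash b n y).length + 1 =
      2 * b * (b + n + b + 1) := by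
  simpa [Nat.add_assoc] using congrArg List.length (front_append_back_append (n := n) (zero := zero) (one := one)
    (hash := hash) hb y)

theorem letter_eq_or (y : ℕ → ℕ → Bool) (i r : ℕ) :
    letter zero one b n y i r = zero ∨ letter zero one b n y i r = one := by
  rw [letter]
  split_ifs <;> simp

theorem letter_ne_hash (h0h : zero ≠ hash) (h1h : one ≠ hash) (y : ℕ → ℕ → Bool) (i r : ℕ) :
    letter zero one b n y i r ≠ hash := by
  rcases letter_eq_or (zero := zero) (one := one) (b := b) (n := n) y i r with h | h <;> rw [h]
  exacts [h0h, h1h]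

theorem charAt_eq_hash_iff (h0h : zero ≠ hash) (h1h : one ≠ hash) {y : ℕ → ℕ → Bool} {t : ℕ} :
    charAt zero one hash b n y t = hash ↔ t % (b + n + b + 1) = b + n + b := by
  rw [charAt]
  split_ifs with h
  · simp [h]
  · simp [h, letter_ne_hash h0h h1h]

theorem charAt_mul_add (y : ℕ → ℕ → Bool) {k r : ℕ} (hr : r < b + n + b) :
    charAt zero one hash b n y (k * (b + n + b + 1) + r) =
      letter zero one b n y (index b k) r := by
  have h1 : (k * (b + n + b + 1) + r) % (b + n + b + 1) = r := 
    Nat.mul_add_mod_of_lt (by omega)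
  have h2 : (k * (b + n + b + 1) + r) / (b + n + b + 1) = k := by
    rw [Nat.mul_comm, Nat.mul_add_div (by omega), Nat.div_eq_of_lt (by omega), Nat.add_zero]
  rw [charAt, h1, h2, if_neg (by omega)]

theorem letter_eq_one_iff (h01 : zero ≠ one) {y : ℕ → ℕ → Bool} {i r : ℕ} :
    letter zero one b n y i r = one ↔
      if r < b then r = i else if r < b + n then y i (r - b) = true else r = b + n + i := by
  rw [letter]
  split_ifs <;> simp_all

theorem index_lt {k : ℕ} (hk : k < 2 * b) : index b k < b := by
  rw [index]
  split_ifs <;> omega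

/-- The letters around a `hash` determine its position. -/
theorem position_unique (h01 : zero ≠ one) (h0h : zero ≠ hash) (h1h : one ≠ hash)
    {y : ℕ → ℕ → Bool} {p p' L j : ℕ} (hp : p + L < 2 * b * (b + n + b + 1))
    (hp' : p' + L < 2 * b * (b + n + b + 1))
    (heq : ∀ i < L, charAt zero one hash b n y (p + i) = charAt zero one hash b n y (p' + i))
    (hj : charAt zero one hash b n y (p + j) = hash) (hbj : b ≤ j) (hjL : j + b < L) : p = p' := by
  have hj' := heq j (by omega) ▸ hj
  rw [charAt_eq_hash_iff h0h h1h] at hj hj'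
  obtain ⟨k, hk⟩ : ∃ k, (p + j) / (b + n + b + 1) = k := ⟨_, rfl⟩
  obtain ⟨k', hk'⟩ : ∃ k, (p' + j) / (b + n + b + 1) = k := ⟨_, rfl⟩
  have e := Nat.div_add_mod' (p + j) (b + n + b + 1)
  have e' := Nat.div_add_mod' (p' + j) (b + n + b + 1)
  rw [hk, hj] at e
  rw [hk', hj'] at e'
  -- The `hash` is not the artificial final one, so a block follows it.
  have hlt : ∀ {q i : ℕ}, i * (b + n + b + 1) + (b + n + b) = q → q + 1 <
      2 * b * (b + n + b + 1) → i + 1 < 2 * b := by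
    intro q i hi hq
    by_contra hcon
    have h3 : 2 * b * (b + n + b + 1) ≤ (i + 1) * (b + n + b + 1) :=
      Nat.mul_le_mul_right _ (by omega)
    rw [Nat.succ_mul i] at h3
    omega
  have hk1 := hlt e (by omega)
  have hk1' := hlt e' (by omega)
  have left : ∀ s < b, letter zero one b n y (index b k) (b + n + s) =
      letter zero one b n y (index b k') (b + n + s) := by
    intro s hs
    have h3 := heq (j - b + s) (by omega)
    rwa [show p + (j - b + s) = k * (b + n + b + 1) + (b + n + s) by omega,
      show p' + (j - b + s) = k' * (b + n + b + 1) + (b + n + s) by omega,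
      charAt_mul_add _ (by omega), charAt_mul_add _ (by omega)] at h3
  have right : ∀ s < b, letter zero one b n y (index b (k + 1)) s =
      letter zero one b n y (index b (k' + 1)) s := by
    intro s hs
    have h3 := heq (j + 1 + s) (by omega)
    rwa [show p + (j + 1 + s) = (k + 1) * (b + n + b + 1) + s by rw [Nat.succ_mul]; omega,
      show p' + (j + 1 + s) = (k' + 1) * (b + n + b + 1) + s by rw [Nat.succ_mul]; omega,
      charAt_mul_add _ (by omega), charAt_mul_add _ (by omega)] at h3
  have l1 : index b k = index b k' := by
    have h3 := left _ (index_lt (b := b) (k := k) (by omega))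
    rw [(letter_eq_one_iff h01).2 (by rw [if_neg (by omega), if_neg (by omega)]), eq_comm,
      letter_eq_one_iff h01, if_neg (by omega), if_neg (by omega)] at h3
    omega
  have l2 : index b (k + 1) = index b (k' + 1) := by
    have hi := index_lt (b := b) (k := k + 1) (by omega)
    have h3 := right _ hi
    rwa [(letter_eq_one_iff h01).2 (by rw [if_pos hi]), eq_comm,
      letter_eq_one_iff h01, if_pos hi] at h3
  -- The numbers run `0, …, b - 1, b - 1, …, 0`, and no ordered pair of neighbours occurs twice: it
  -- ascends in the first half, is constant in the middle and descends in the second half.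
  have hkk : k = k' := by
    simp only [index] at l1 l2
    split_ifs at l1 l2 <;> omega
  subst hkk
  omega

open Classical in
/-- The lists all of whose occurrences of `hash` are near the ends. -/
noncomputable def sparse (zero one hash : A) (b n : ℕ) : Finset (List A) :=
  ((({zero, one, hash} : Finset A).listsUpTo b ×ˢ ({zero, one} : Finset A).listsUpTo (b + n + b))
    ×ˢ ({zero, one, hash} : Finset A).listsUpTo b).image fun p => p.1.1 ++ (p.1.2 ++ p.2)

-- Only the middle part depends on `n`, and it uses two letters, which gives the factor `2 ^ n`. The
-- summand `1` leaves room for an undefined value.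
open Classical in
theorem exists_card_sparse_lt (zero one hash : A) (b : ℕ) :
    ∃ K, ∀ n, (sparse zero one hash b n).card + 1 ≤ K * 2 ^ n := by
  refine ⟨(({zero, one, hash} : Finset A).listsUpTo b).card * 2 ^ (b + b + 1) *
    (({zero, one, hash} : Finset A).listsUpTo b).card + 1, fun n => ?_⟩
  have h1 : (sparse zero one hash b n).card ≤ _ := Finset.card_image_le
  rw [Finset.card_product, Finset.card_product] at h1
  have h2 := (Finset.card_listsUpTo_lt (Finset.card_le_two (a := zero) (b := one)) (b + n + b)).le
  rw [show b + n + b + 1 = (b + b + 1) + n by omega, pow_add] at h2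
  have h3 := h1.trans (Nat.mul_le_mul_right _ (Nat.mul_le_mul_left _ h2))
  have h4 := Nat.one_le_two_pow (n := n)
  calc _ ≤ _ := Nat.add_le_add h3 h4
    _ = _ := by ring

/-- A list that occurs at two positions of the mirror word is sparse. -/
theorem mem_sparse (h01 : zero ≠ one) (h0h : zero ≠ hash) (h1h : one ≠ hash)
    {y : ℕ → ℕ → Bool} {p p' : ℕ} {z : List A} (hne : p ≠ p')
    (hp : p + z.length < 2 * b * (b + n + b + 1)) (hp' : p' + z.length < 2 * b * (b + n + b + 1))
    (hz : ∀ (i : ℕ) (hi : i < z.length), z[i] = charAt zero one hash b n y (p + i))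
    (hz' : ∀ (i : ℕ) (hi : i < z.length), z[i] = charAt zero one hash b n y (p' + i)) :
    z ∈ sparse zero one hash b n := by
  classical
  have mem3 : ∀ a ∈ z, a ∈ ({zero, one, hash} : Finset A) := by
    intro a ha
    obtain ⟨i, hi, rfl⟩ := List.mem_iff_getElem.1 ha
    rw [hz i hi, charAt]
    split_ifs
    · simp
    · rcases letter_eq_or (zero := zero) (one := one) (b := b) (n := n) y
        (index b ((p + i) / (b + n + b + 1))) ((p + i) % (b + n + b + 1)) with h | h <;> simp [h]
  have mid : ∀ (i : ℕ) (hi : i < z.length), b ≤ i → i + b < z.length → z[i] ≠ hash := by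
    intro i hi h1 h2 h3
    refine hne (position_unique h01 h0h h1h hp hp' (fun i hi => ?_) (hz i hi ▸ h3) h1 h2)
    rw [← hz i hi, ← hz' i hi]
  have hlen : z.length ≤ b + (b + n + b) + b := by
    by_contra hcon
    -- This is the first `hash` at or after offset `b`; in a longer list it would still have `b`
    -- letters behind it.
    obtain ⟨i, hi⟩ : ∃ i, i = b + (b + n + b - (p + b) % (b + n + b + 1)) := ⟨_, rfl⟩
    have hlt := Nat.mod_lt (p + b) (show 0 < b + n + b + 1 by omega)
    refine mid i (by omega) (by omega) (by omega) ?_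
    rw [hz i (by omega), charAt_eq_hash_iff h0h h1h]
    have e := Nat.div_add_mod' (p + b) (b + n + b + 1)
    rw [show p + i = (p + b) / (b + n + b + 1) * (b + n + b + 1) + (b + n + b) by omega,
      Nat.mul_add_mod_of_lt (by omega)]
  -- For a list shorter than `2 * b` the truncated subtraction makes the middle part empty, and the
  -- remainder still has length at most `b`.
  refine Finset.mem_image.2 ⟨((z.take b, (z.drop b).take (z.length - 2 * b)),
    (z.drop b).drop (z.length - 2 * b)), ?_, by simp⟩
  refine Finset.mem_product.2 ⟨Finset.mem_product.2 ⟨?_, ?_⟩, ?_⟩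
  · exact Finset.mem_listsUpTo (fun a ha => mem3 a (List.mem_of_mem_take ha)) (by simp)
  · refine Finset.mem_listsUpTo (fun a ha => ?_) (by simp; omega)
    have h1 := mem3 a (List.mem_of_mem_drop (List.mem_of_mem_take ha))
    obtain ⟨i, hi, rfl⟩ := List.mem_iff_getElem.1 ha
    simp only [List.length_take, List.length_drop] at hi
    have h2 := mid (b + i) (by omega) (by omega) (by omega)
    simp only [List.getElem_take, List.getElem_drop] at h1 ⊢
    simpa [h2] using h1
  · refine Finset.mem_listsUpTo
      (fun a ha => mem3 a (List.mem_of_mem_drop (List.mem_of_mem_drop ha))) (by simp; omega)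

theorem getElem_of_eq (hb : 0 < b) {y : ℕ → ℕ → Bool} {s z t : List A}
    (h : front zero one hash b n y ++ back zero one hash b n y = s ++ z ++ t) :
    s.length + z.length < 2 * b * (b + n + b + 1) ∧
      ∀ (i : ℕ) (hi : i < z.length), z[i] = charAt zero one hash b n y (s.length + i) := by
  have hl := length_front_add (n := n) (zero := zero) (one := one) (hash := hash) hb y
  have h1 := congrArg List.length h
  simp only [List.length_append] at h1
  refine ⟨by omega, fun i hi => ?_⟩
  have h2 := front_append_back_append (n := n) (zero := zero) (one := one) (hash := hash) hb y
  rw [h] at h2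
  have h3 := congrArg (fun l => l[s.length + i]?) h2
  simp only [List.append_assoc, List.getElem?_map] at h3
  rw [List.getElem?_append_right (by omega), List.getElem?_append_left (by omega),
    List.getElem?_range (by omega)] at h3
  simpa [hi] using h3

/-- One occurrence ends inside the first half and the other behind it, so a nonempty list has two
different positions. -/
theorem mem_sparse_of_occursBeyond (h01 : zero ≠ one) (h0h : zero ≠ hash) (h1h : one ≠ hash)
    (hb : 0 < b) {y : ℕ → ℕ → Bool} {z : List A} (hz : z <:+: front zero one hash b n y)
    (hz' : PRE.OccursBeyond (front zero one hash b n y) (back zero one hash b n y) z) :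
    z ∈ sparse zero one hash b n := by
  classical
  rcases eq_or_ne z [] with rfl | hne
  · exact Finset.mem_image.2 ⟨(([], []), []), by simp [Finset.mem_listsUpTo], rfl⟩
  obtain ⟨s, t, hst⟩ := hz
  obtain ⟨s', t', hst', hlt⟩ : ∃ s' t', front zero one hash b n y ++ back zero one hash b n y =
      s' ++ z ++ t' ∧ (front zero one hash b n y).length < s'.length + z.length := by
    rcases hz' with ⟨s', t', h⟩ | ⟨u, v, rfl, hv, ⟨s', h1⟩, ⟨t', h2⟩⟩
    · refine ⟨front zero one hash b n y ++ s', t', by rw [← h]; simp, ?_⟩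
      have := List.length_pos_iff.2 hne
      rw [List.length_append]
      omega
    · refine ⟨s', t', ?_, ?_⟩
      · conv_lhs => rw [← h1, ← h2]
        simp
      · rw [← h1]
        have := List.length_pos_iff.2 hv
        simp only [List.length_append]
        omega
  have h3 : front zero one hash b n y ++ back zero one hash b n y =
      s ++ z ++ (t ++ back zero one hash b n y) := by
    rw [← List.append_assoc, hst]
  have h4 := congrArg List.length hst
  simp only [List.length_append] at h4
  obtain ⟨g1, g2⟩ := getElem_of_eq hb h3
  obtain ⟨g3, g4⟩ := getElem_of_eq hb hst'
  exact mem_sparse h01 h0h h1h (by omega) g1 g3 g2 g4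

theorem hash_notMem_block (h0h : zero ≠ hash) (h1h : one ≠ hash) (y : ℕ → ℕ → Bool) (i : ℕ) :
    hash ∉ block zero one b n y i := by
  simp only [block, List.mem_map, not_exists, not_and]
  exact fun r _ => letter_ne_hash h0h h1h y i r

theorem mem_mirrorLanguage (hb : 0 < b) (y : ℕ → ℕ → Bool) :
    front zero one hash b n y ++ back zero one hash b n y ∈ mirrorLanguage zero one hash b := by
  refine ⟨blocks zero one b n y, by simp [blocks], ?_, front_append_back hb y y⟩
  intro w hw a ha
  obtain ⟨i, -, rfl⟩ := List.mem_map.1 hw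
  obtain ⟨r, -, rfl⟩ := List.mem_map.1 ha
  exact letter_eq_or y i r

/-- A word with different halves is not in the language. -/
theorem eq_of_mem_mirrorLanguage (h01 : zero ≠ one) (h0h : zero ≠ hash) (h1h : one ≠ hash)
    (hb : 0 < b) {y y' : ℕ → ℕ → Bool}
    (h : front zero one hash b n y ++ back zero one hash b n y' ∈ mirrorLanguage zero one hash b)
    {i r : ℕ} (hi : i < b) (hr : r < n) : y i r = y' i r := by
  classical
  obtain ⟨ws, hlen, hws, h⟩ := h
  have hws' : ∀ w ∈ ws, hash ∉ w := fun w hw hmem => by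
    rcases hws w hw hash hmem with h | h
    exacts [h0h h.symm, h1h h.symm]
  have hbl : ∀ y, ∀ w ∈ blocks zero one b n y, hash ∉ w := by
    intro y w hw
    obtain ⟨i, -, rfl⟩ := List.mem_map.1 hw
    exact hash_notMem_block h0h h1h y i
  have hw0 : ws ≠ [] := by
    rintro rfl
    simp at hlen
    omega
  rw [front_append_back hb] at h
  -- No block contains `hash`, so splitting there recovers the blocks; both halves must then come
  -- from the same list `ws`.
  have h2 := congrArg (List.splitOn hash) h
  rw [List.splitOn_intercalate hash ?_ (by simp [blocks_ne_nil hb]),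
    List.splitOn_intercalate hash ?_ (by simp [hw0])] at h2
  rotate_left
  · intro w hw
    simp only [List.mem_append, List.mem_reverse] at hw
    exact hw.elim (hws' w) (hws' w)
  · intro w hw
    simp only [List.mem_append, List.mem_reverse] at hw
    exact hw.elim (hbl y w) (hbl y' w)
  obtain ⟨h3, h4⟩ := List.append_inj h2 (by simp [blocks, hlen])
  have h5 : blocks zero one b n y = blocks zero one b n y' := by
    rw [h3, ← List.reverse_inj, h4]
  have h6 := List.map_inj_left.1 h5 i (List.mem_range.2 hi)
  -- The free bits of a block start after the `b` letters of the first marker.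
  have h7 := List.map_inj_left.1 h6 (b + r) (List.mem_range.2 (by omega))
  have h8 := (letter_eq_one_iff (b := b) (n := n) h01 (y := y) (i := i) (r := b + r))
  rw [h7, letter_eq_one_iff h01, if_neg (by omega), if_pos (by omega), if_neg (by omega),
    if_pos (by omega), Nat.add_sub_cancel_left] at h8
  exact (Bool.eq_iff_iff.2 h8).symm

end MirrorWord

/-! ### An expression with non-nested variables for the mirror language -/

namespace MirrorWord

variable {A : Type*}

open PRE

/-- An expression for the words over `{zero, one}`. -/
def wordExpr (zero one : A) : PRE A := star (union (char zero) (char one))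

/-- An expression for `w₁ # ⋯ w_k #`, whose groups are the words. -/
def groupsExpr (zero one hash : A) : ℕ → PRE A
  | 0 => epsilon
  | k + 1 => concat (groupsExpr zero one hash k) (concat (group (wordExpr zero one)) (char hash))

/-- The references `\(k + 1) # ⋯ # \1`. -/
def refsExpr (hash : A) : ℕ → PRE A
  | 0 => backref 1
  | k + 1 => concat (backref (k + 2)) (concat (char hash) (refsExpr hash k))

/-- An expression for the mirror language with `k + 1` words. -/
def mirrorExpr (zero one hash : A) (k : ℕ) : PRE A :=
  concat (groupsExpr zero one hash (k + 1)) (refsExpr hash k)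

variable {zero one hash : A}

theorem numGroups_groupsExpr (k : ℕ) : numGroups (groupsExpr zero one hash k) = k := by
  induction k with
  | zero => rfl
  | succ k ih => simp [groupsExpr, numGroups, ih, wordExpr]

theorem vars_groupsExpr (k : ℕ) : vars (groupsExpr zero one hash k) = ∅ := by
  induction k with
  | zero => rfl
  | succ k ih => simp [groupsExpr, vars, ih, wordExpr]

theorem validAt_groupsExpr (m : ℕ) (O : Finset ℕ) (k : ℕ) :
    ValidAt m O (groupsExpr zero one hash k) := by
  induction k with
  | zero => trivial
  | succ k ih => simp [groupsExpr, ValidAt, ih, wordExpr]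

theorem nonNestedAt_groupsExpr (V : Finset ℕ) (m k : ℕ) :
    NonNestedAt V m (groupsExpr zero one hash k) := by
  induction k with
  | zero => trivial
  | succ k ih =>
    simp only [groupsExpr, NonNestedAt, ih, wordExpr, vars, numGroups]
    simp

theorem vars_refsExpr_subset (k : ℕ) : vars (refsExpr hash k) ⊆ Finset.Icc 1 (k + 1) := by
  induction k with
  | zero => simp [refsExpr, vars]
  | succ k ih =>
    simp only [refsExpr, vars, Finset.empty_union]
    refine Finset.union_subset (by simp) (ih.trans (Finset.Icc_subset_Icc_right (by omega)))

theorem validAt_refsExpr {m k : ℕ} (h : k < m) : ValidAt m ∅ (refsExpr hash k) := by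
  induction k with
  | zero => simp [refsExpr, ValidAt]; omega
  | succ k ih => simp [refsExpr, ValidAt, numGroups, ih (by omega)]; omega

theorem nonNestedAt_refsExpr (V : Finset ℕ) (m k : ℕ) : NonNestedAt V m (refsExpr hash k) := by
  induction k with
  | zero => trivial
  | succ k ih => simp [refsExpr, NonNestedAt, numGroups, ih]

theorem matches_wordExpr_iff {m : ℕ} {σ τ : ℕ → Option (List A)} {w : List A} :
    Matches m (wordExpr zero one) σ w τ ↔ τ = σ ∧ ∀ a ∈ w, a = zero ∨ a = one := by
  constructor
  · intro h
    generalize hr : wordExpr zero one = r at h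
    induction h with
    | star_nil => simp
    | star_cons h _ _ ih =>
      obtain ⟨rfl, h2⟩ := ih hr
      rw [wordExpr, star.injEq] at hr
      subst hr
      cases h with
      | union_left h => cases h; simpa using h2
      | union_right h => cases h; simpa using h2
    | _ => cases hr
  · rintro ⟨rfl, h⟩
    induction w with
    | nil => exact .star_nil _ _ _
    | cons a w ih =>
      refine .star_cons (u := [a]) ?_ (ih fun b hb => h b (List.mem_cons_of_mem _ hb))
      rcases h a List.mem_cons_self with rfl | rfl
      exacts [.union_left (.char _ _ _), .union_right (.char _ _ _)]

/-- The store in which the values of the groups `1, 2, …` are the given words. -/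
def storeOf (ws : List (List A)) (j : ℕ) : Option (List A) :=
  if j = 0 then none else ws[j - 1]?

theorem storeOf_append (ws : List (List A)) (w : List A) :
    storeOf (ws ++ [w]) = Function.update (storeOf ws) (ws.length + 1) (some w) := by
  funext j
  by_cases hj : j = ws.length + 1
  · subst hj
    simp [storeOf]
  · rw [Function.update_of_ne hj]
    cases j with
    | zero => rfl
    | succ j =>
      simp only [storeOf, Nat.add_one_ne_zero, if_false, Nat.add_sub_cancel]
      rcases lt_or_gt_of_ne (show j ≠ ws.length by omega) with h | h
      · rw [List.getElem?_append_left h]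
      · rw [List.getElem?_eq_none (by simp; omega), List.getElem?_eq_none (by omega)]

theorem matches_groupsExpr_iff {k : ℕ} {u : List A} {τ : ℕ → Option (List A)} :
    Matches 0 (groupsExpr zero one hash k) (fun _ => none) u τ ↔
      ∃ ws : List (List A), ws.length = k ∧ (∀ w ∈ ws, ∀ a ∈ w, a = zero ∨ a = one) ∧
        u = ws.flatMap (· ++ [hash]) ∧ τ = storeOf ws := by
  induction k generalizing u τ with
  | zero =>
    have hs : storeOf ([] : List (List A)) = fun _ => none := by
      funext j
      simp [storeOf]
    constructor
    · intro h
      cases h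
      exact ⟨[], by simp [hs]⟩
    · rintro ⟨ws, h1, -, rfl, rfl⟩
      obtain rfl := List.length_eq_zero_iff.1 h1
      rw [hs]
      exact .epsilon _ _
  | succ k ih =>
    constructor
    · intro h
      cases h with
      | concat h h' =>
        cases h' with
        | concat h' h'' =>
          cases h' with
          | group h' =>
            cases h''
            obtain ⟨rfl, h3⟩ := matches_wordExpr_iff.1 h'
            obtain ⟨ws, h4, h5, rfl, rfl⟩ := ih.1 h
            refine ⟨ws ++ [_], by simp [h4], ?_, by simp; rfl, ?_⟩
            · intro w hw
              rcases List.mem_append.1 hw with hw | hw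
              · exact h5 w hw
              · exact List.mem_singleton.1 hw ▸ h3
            · rw [storeOf_append, h4, numGroups_groupsExpr, Nat.zero_add]
    · rintro ⟨ws, h1, h2, rfl, rfl⟩
      obtain ⟨ws, w, rfl⟩ : ∃ ws' w, ws = ws' ++ [w] := by
        refine ⟨ws.dropLast, ws.getLast ?_, (List.dropLast_append_getLast _).symm⟩
        rintro rfl
        simp at h1
      simp only [List.length_append, List.length_singleton, Nat.add_right_cancel_iff] at h1
      rw [storeOf_append, List.flatMap_append, h1]
      refine .concat (ih.2 ⟨ws, h1, fun w hw => h2 w (List.mem_append_left _ hw), rfl, rfl⟩) ?_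
      rw [numGroups_groupsExpr, Nat.zero_add, List.flatMap_singleton]
      exact .concat (.group (matches_wordExpr_iff.2 ⟨rfl, h2 w (by simp)⟩)) (.char _ _ _)

/-- The store is constrained only at the groups `1, …, k + 1`, so that in the induction it stays
fixed while the list of words loses its last entry. -/
theorem matches_refsExpr_iff {m k : ℕ} {ws : List (List A)} {σ τ : ℕ → Option (List A)}
    {v : List A} (hl : ws.length = k + 1) (hσ : ∀ i ≤ k, σ (i + 1) = ws[i]?) :
    Matches m (refsExpr hash k) σ v τ ↔ v = [hash].intercalate ws.reverse ∧ τ = σ := by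
  induction k generalizing m ws v with
  | zero =>
    obtain ⟨w, rfl⟩ := List.length_eq_one_iff.1 hl
    have h1 : σ 1 = some w := by simpa using hσ 0 le_rfl
    constructor
    · intro h
      cases h with
      | backref h =>
        rw [h1, Option.some.injEq] at h
        simp [List.intercalate, h]
    · rintro ⟨rfl, rfl⟩
      exact .backref (by simp [List.intercalate, h1])
  | succ k ih =>
    obtain ⟨ws, w, rfl⟩ : ∃ ws' w, ws = ws' ++ [w] := by
      refine ⟨ws.dropLast, ws.getLast ?_, (List.dropLast_append_getLast _).symm⟩
      rintro rfl
      simp at hl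
    simp only [List.length_append, List.length_singleton, Nat.add_right_cancel_iff] at hl
    have h1 : σ (k + 2) = some w := by
      rw [hσ (k + 1) le_rfl, ← hl, List.getElem?_concat_length]
    have h2 : ∀ i ≤ k, σ (i + 1) = ws[i]? := fun i hi => by
      rw [hσ i (by omega), List.getElem?_append_left (by omega)]
    have h3 : [hash].intercalate (ws ++ [w]).reverse =
        w ++ ([hash] ++ [hash].intercalate ws.reverse) := by
      have h := List.intercalate_append [hash] [w] (L' := ws.reverse)
        (by rintro h; simp_all)
      simpa using h
    rw [h3]
    constructor
    · intro h
      cases h with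
      | concat h h' =>
        cases h with
        | backref h =>
          rw [h1, Option.some.injEq] at h
          subst h
          cases h' with
          | concat h h' =>
            cases h
            obtain ⟨rfl, rfl⟩ := (ih hl h2).1 h'
            exact ⟨rfl, rfl⟩
    · rintro ⟨rfl, rfl⟩
      exact .concat (.backref h1) (.concat (.char _ _ _) ((ih hl h2).2 ⟨rfl, rfl⟩))

theorem language_mirrorExpr (k : ℕ) :
    (mirrorExpr zero one hash k).language = mirrorLanguage zero one hash (k + 1) := by
  have hint : ∀ ws : List (List A), ws.length = k + 1 → [hash].intercalate (ws ++ ws.reverse) =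
      ws.flatMap (· ++ [hash]) ++ [hash].intercalate ws.reverse := fun ws h =>
    List.intercalate_append _ _ (by rintro h'; simp_all)
  have hst : ∀ ws : List (List A), ∀ i ≤ k, storeOf ws (i + 1) = ws[i]? := by simp [storeOf]
  apply Set.ext
  intro x
  constructor
  · rintro ⟨τ, h⟩
    cases h with
    | concat h h' =>
      obtain ⟨ws, h1, h2, rfl, rfl⟩ := matches_groupsExpr_iff.1 h
      obtain ⟨rfl, -⟩ := (matches_refsExpr_iff h1 (hst ws)).1 h'
      exact ⟨ws, h1, h2, (hint ws h1).symm⟩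
  · rintro ⟨ws, h1, h2, rfl⟩
    rw [hint ws h1]
    exact ⟨_, .concat (matches_groupsExpr_iff.2 ⟨ws, h1, h2, rfl, rfl⟩)
      ((matches_refsExpr_iff h1 (hst ws)).2 ⟨rfl, rfl⟩)⟩

theorem mirrorLanguage_mem_nonNestedClass (zero one hash : A) (k : ℕ) :
    mirrorLanguage zero one hash (k + 1) ∈ NonNestedClass A (k + 1) := by
  refine ⟨mirrorExpr zero one hash k, ?_, ?_, ?_, language_mirrorExpr k⟩
  · refine ⟨validAt_groupsExpr _ _ _, validAt_refsExpr ?_⟩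
    rw [numGroups_groupsExpr]
    omega
  · exact ⟨nonNestedAt_groupsExpr _ _ _, nonNestedAt_refsExpr _ _ _⟩
  · rw [mirrorExpr, vars, vars_groupsExpr, Finset.empty_union]
    simpa using Finset.card_le_card (vars_refsExpr_subset (hash := hash) k)

/-! ### The counting argument for the lower bound -/

theorem exists_add_mul_lt_two_pow (a c : ℕ) : ∃ n, a + c * n < 2 ^ n := by
  -- For this `n` the power is the square of `2 ^ (a + 2 * c)`, hence at least `(a + 2 * c + 1) ^
  -- 2`.
  refine ⟨2 * (a + 2 * c), ?_⟩
  have h := Nat.lt_two_pow_self (n := a + 2 * c)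
  have h' := Nat.mul_le_mul h h
  rw [Nat.mul_comm, pow_mul', sq]
  refine lt_of_lt_of_le ?_ h'
  nlinarith

/-- The blocks given by finitely many bits. -/
def extend {b n : ℕ} (y : Fin b → Fin n → Bool) (i r : ℕ) : Bool :=
  if h : i < b ∧ r < n then y ⟨i, h.1⟩ ⟨r, h.2⟩ else false

theorem mirrorLanguage_notMem_class (h01 : zero ≠ one) (h0h : zero ≠ hash) (h1h : one ≠ hash)
    (k : ℕ) : mirrorLanguage zero one hash (k + 1) ∉ Class A k := by
  classical
  rintro ⟨r, hr, hcard, hL⟩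
  obtain ⟨K, hK⟩ := exists_card_sparse_lt zero one hash (k + 1)
  obtain ⟨P, hP⟩ : ∃ P, ((Finset.univ : Finset Bool).listsUpTo (height r)).card = P := ⟨_, rfl⟩
  -- The two arguments are the coefficients of `P * (N + 1) * K ^ k` as a polynomial of degree one
  -- in `n`.
  obtain ⟨n, hn⟩ := exists_add_mul_lt_two_pow
    (P * (2 * (k + 1) * (2 * (k + 1) + 1) + 1) * K ^ k) (P * (2 * (k + 1)) * K ^ k)
  obtain ⟨N, hN⟩ : ∃ N, 2 * (k + 1) * (k + 1 + n + (k + 1) + 1) = N := ⟨_, rfl⟩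
  have hmem : ∀ y : ℕ → ℕ → Bool, front zero one hash (k + 1) n y ++
      back zero one hash (k + 1) n y ∈ r.language := fun y => by
    rw [hL]
    exact mem_mirrorLanguage (Nat.succ_pos k) y
  choose π j ρ ρ₀ τ h1 h2 h3 h4 using fun y => hr.exists_cut (hmem y)
  -- Restricting the store to the variables loses nothing, as the pruned store is undefined
  -- elsewhere.
  let configs : Finset (List Bool × ℕ × (r.vars → Option (List A))) :=
    (Finset.univ : Finset Bool).listsUpTo (height r) ×ˢ Finset.range (N + 1) ×ˢ
      Fintype.piFinset fun _ : r.vars => Finset.insertNone (sparse zero one hash (k + 1) n)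
  let config : (Fin (k + 1) → Fin n → Bool) → List Bool × ℕ × (r.vars → Option (List A)) :=
    fun y => (π (extend y), j (extend y), fun i => ρ₀ (extend y) i)
  have hmaps : ∀ y ∈ (Finset.univ : Finset (Fin (k + 1) → Fin n → Bool)),
      config y ∈ configs := by
    intro y _
    refine Finset.mem_product.2 ⟨?_, Finset.mem_product.2 ⟨?_, ?_⟩⟩
    · exact Finset.mem_listsUpTo (by simp) (h1 _).length_path_le
    · have := (h1 (extend y)).offset_le
      have := length_front_add (n := n) (zero := zero) (one := one) (hash := hash) (b := k + 1)
        (Nat.succ_pos k) (extend y)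
      simp only [config, Finset.mem_range]
      omega
    · refine Fintype.mem_piFinset.2 fun i => Finset.mem_insertNone.2 fun z hz => ?_
      obtain ⟨-, h5, h6⟩ := h4 (extend y) i z hz
      exact mem_sparse_of_occursBeyond h01 h0h h1h (Nat.succ_pos k) h5 h6
  have hlt : configs.card < (Finset.univ : Finset (Fin (k + 1) → Fin n → Bool)).card := by
    have h5 : ((sparse zero one hash (k + 1) n).card + 1) ^ r.vars.card ≤ (K * 2 ^ n) ^ k :=
      (Nat.pow_le_pow_right (Nat.succ_pos _) hcard).trans (Nat.pow_le_pow_left (hK n) _)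
    simp only [configs, Finset.card_product, hP, Finset.card_range, Fintype.card_piFinset,
      Finset.card_insertNone, Finset.prod_const, Finset.card_univ, Fintype.card_coe,
      Fintype.card_fun, Fintype.card_fin, Fintype.card_bool]
    calc _ ≤ P * ((N + 1) * (K * 2 ^ n) ^ k) :=
          Nat.mul_le_mul_left _ (Nat.mul_le_mul_left _ h5)
      _ = (P * (2 * (k + 1) * (2 * (k + 1) + 1) + 1) * K ^ k + P * (2 * (k + 1)) * K ^ k * n) *
          (2 ^ n) ^ k := by rw [← hN, mul_pow]; ring
      -- With `k` variables for `k + 1` blocks, one factor `2 ^ n` remains to beat the linear term.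
      _ < 2 ^ n * (2 ^ n) ^ k := Nat.mul_lt_mul_of_pos_right hn (by positivity)
      _ = _ := by rw [pow_succ']
  obtain ⟨y, -, y', -, hne, heq⟩ := Finset.exists_ne_map_eq_of_card_lt_of_maps_to hlt hmaps
  simp only [config, Prod.mk.injEq] at heq
  obtain ⟨hπ, hj, hρ⟩ := heq
  have hsub : Sub (ρ₀ (extend y')) (ρ (extend y)) := by
    intro i z hz
    have hi := congrFun hρ ⟨i, (h4 _ i z hz).1⟩
    exact h2 _ i z (hi.trans hz)
  -- The first half of the match for `y` is continued by the second half of the match for `y'`.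
  obtain ⟨τ', -, h⟩ := (h1 (extend y)).join (hπ ▸ hj ▸ h3 (extend y')) hsub
  have h : front zero one hash (k + 1) n (extend y) ++ back zero one hash (k + 1) n (extend y') ∈
      mirrorLanguage zero one hash (k + 1) := hL ▸ ⟨τ', h⟩
  refine hne (funext fun i => funext fun s => ?_)
  simpa [extend, i.is_le] using eq_of_mem_mirrorLanguage h01 h0h h1h (Nat.succ_pos k) h i.2 s.2

end MirrorWord

theorem theorem6 {A : Type*} (zero one hash : A) (h01 : zero ≠ one) (h0h : zero ≠ hash)
    (h1h : one ≠ hash) (b : ℕ) (hb : 0 < b) :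
    PRE.NonNestedClass A (b - 1) ⊂ PRE.NonNestedClass A b ∧
      mirrorLanguage zero one hash b ∈ PRE.NonNestedClass A b ∧
      mirrorLanguage zero one hash b ∉ PRE.Class A (b - 1) := by
  obtain ⟨k, rfl⟩ := Nat.exists_eq_succ_of_ne_zero hb.ne'
  have h1 := MirrorWord.mirrorLanguage_mem_nonNestedClass zero one hash k
  have h2 := MirrorWord.mirrorLanguage_notMem_class h01 h0h h1h k
  refine ⟨⟨?_, fun h => ?_⟩, h1, h2⟩
  · rintro L ⟨r, hv, hn, hc, hL⟩
    exact ⟨r, hv, hn, hc.trans (Nat.le_succ k), hL⟩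
  · obtain ⟨r, hv, -, hc, hL⟩ := h h1
    exact h2 ⟨r, hv, hc, hL⟩
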